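/- **Model.** A UAV of mass $m_{UAV}>0$ and symmetric positive definite inertia matrix $H_{UAV}$ carries a rigidly attached payload of mass $m_{PL}\ge 0$ and symmetric positive semidefinite inertia matrix $H_{PL}$; gravity is $g>0$. In the body-fixed frame centred at the centre of gravity of the UAV alone, the payload is at $r_{PL}$ and the point of interest (POI) at $r_{POI}$. Put $m_{tot}=m_{UAV}+m_{PL}$, $\hat r=r_{POI}-\frac{m_{PL}}{m_{tot}}r_{PL}$ and $$\alpha=z_{POI}-\tfrac{m_{PL}}{m_{tot}}z_{PL}.$$ Let $S(a)b=a\times b$, let $R=R_z(\psi)R_y(\theta)R_x(\varphi)$ for Euler angles $\eta=(\varphi,\theta,\psi)$, and let $\omega=\Gamma(\eta)\dot\eta$ be the body-fixed angular velocity, with $\Gamma=\begin{pmatrix}1&0&-\sin\theta\\0&\cos\varphi&\sin\varphi\cos\theta\\0&-\sin\varphi&\cos\varphi\cos\theta\end{pmatrix}$. Let $p\in\mathbb R^3$ be the inertial position of the POI, $F=(T,\tau_\varphi,\tau_\theta,\tau_\psi)$ the input (thrust and torques), and put $H_{CoG}=\frac{m_{UAV}m_{PL}}{m_{tot}}S(r_{PL})^\top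 S(r_{PL})+H_{UAV}+H_{PL}$, $M_1=H_{CoG}+m_{tot}S(\hat r)^\top S(\hat r)$, $M_2=S(\hat r)S(\omega)-S(\omega)S(\hat r)$, $M_3=m_{tot}(\Gamma^{-\top}\otimes\dot p^\top)R_\eta S(\hat r)$, where $R_\eta$ stacks $\partial R/\partial\varphi,\partial R/\partial\theta,\partial R/\partial\psi$ vertically. The model is $$B_y\begin{pmatrix}\ddot p\\\dot\omega\end{pmatrix}+M_5=M_F F,\quad \dot\eta=\Gamma^{-1}\omega,\quad M_5=C_y\begin{pmatrix}\dot p\\\omega\end{pmatrix}+G_y,\quad M_F=\begin{pmatrix}Re_3&0\\0&I_3\end{pmatrix},$$ $$B_y=\begin{pmatrix}m_{tot}I_3&m_{tot}RS(\hat r)\\m_{tot}S(\hat r)^\top R^\top&M_1\end{pmatrix},\quad C_y=\begin{pmatrix}0&m_{tot}RS(\omega)S(\hat r)\\m_{tot}M_2R^\top&S(\omega)M_1-M_3\end{pmatrix},\quad G_y=\begin{pmatrix}m_{tot}g\,e_3\\m_{tot}g\,S(\hat r)^\top\Gamma e_3\end{pmatrix}.$$ The output is $(p,\omega_z)$. Let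 $M_4=\begin{pmatrix}I_3&0\\0&e_3^\top\end{pmatrix}B_y^{-1}$, so that $(\ddot p,\dot\omega_z)=M_4M_FF-M_4M_5$. The *zero dynamics* $\dot z=f_{zd}(z)$, $z=(\omega_x,\omega_y,\varphi,\theta,\psi)$, are the equations for $z$ obtained from the model with $p=\dot p=0$, $\omega_z=0$ under the input-output linearizing feedback $F=(M_4M_F)^{-1}M_4M_5$, which makes $\ddot p=0$ and $\dot\omega_z=0$. **Theorem.** 1. If $\alpha\ne0$, then $M_4M_F$ is invertible for every $\eta$, the origin (hover) is an equilibrium of the zero dynamics, $f_{zd}$ is differentiable there, and its Jacobian at the origin is $$J=\begin{pmatrix}0&0&-g/\alpha&0&0\\0&0&0&-g/\alpha&0\\1&0&0&0&0\\0&1&0&0&0\\0&0&0&0&0\end{pmatrix},$$ with eigenvalues, counted with multiplicity, $0,\ \sqrt{-g/\alpha},\ \sqrt{-g/\alpha},\ -\sqrt{-g/\alpha},\ -\sqrt{-g/\alpha}$. 2. If $\alpha<0$, then the origin is an unstable equilibrium (not Lyapunov stable) of the nonlinear zero dynamics $\dot z=f_{zd}(z)$. 3. If $\alpha\ge 0$,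 then the linearized zero dynamics are marginally stable, that is, the origin is Lyapunov stable but not asymptotically stable. For $\alpha>0$ this holds for $\dot z=Jz$. For every $\alpha\ge0$, including $\alpha=0$, where the linearizing feedback and $J$ do not exist, it holds for the zero-output dynamics of the linearized model: the model, with state $x=(\dot p,\omega,p,\eta)$, is differentiable at the equilibrium $x=0$, $F=(m_{tot}g,\ m_{tot}g\,S(\hat r)^\top e_3)$, and the dynamics in question consist of all state trajectories of its linearization there, for any input, along which the output $(p,\omega_z)$ vanishes identically. -/

import Mathlib

open Matrix Set Filter Topology

noncomputable section

namespace UAVPayload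

/-! ### Stability notions for autonomous differential inclusions `z' ∈ F z`, at the origin -/

section Stability

variable {E : Type*} [NormedAddCommGroup E] [NormedSpace ℝ E]

/-- The right-hand side of the ordinary differential equation `z' = f z`. -/
def ode (f : E → E) : E → Set E := fun z => {f z}

/-- `z` solves `z' ∈ F z` on the time interval `[0, T]`. -/
def IsSolution (F : E → Set E) (T : ℝ) (z : ℝ → E) : Prop :=
  ∀ t ∈ Icc 0 T, ∃ v ∈ F (z t), HasDerivWithinAt z v (Icc 0 T) t

/-- Lyapunov stability of the origin. -/
def LyapunovStable (F : E → Set E) : Prop :=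
  ∀ ε > 0, ∃ δ > 0, ∀ (T : ℝ) (z : ℝ → E), IsSolution F T z → ‖z 0‖ < δ →
    ∀ t ∈ Icc 0 T, ‖z t‖ < ε

/-- The origin is unstable: it is not Lyapunov stable. -/
def Unstable (F : E → Set E) : Prop := ¬ LyapunovStable F

/-- Local attractivity of the origin: solutions on `[0, ∞)` that start close enough to the origin
converge to it. -/
def Attractive (F : E → Set E) : Prop :=
  ∃ δ > 0, ∀ z : ℝ → E, (∀ T : ℝ, IsSolution F T z) → ‖z 0‖ < δ → Tendsto z atTop (𝓝 0)

/-- Marginal stability of the origin: Lyapunov stable, but not asymptotically stable. -/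
def MarginallyStable (F : E → Set E) : Prop := LyapunovStable F ∧ ¬ Attractive F

end Stability

/-! ### The multirotor UAV with a rigidly attached payload -/

/-- Vectors of `ℝ³`. -/
abbrev V3 : Type := Fin 3 → ℝ

/-- The third unit vector. -/
def e3 : V3 := ![0, 0, 1]

/-- The skew-symmetric matrix with `skew a *ᵥ b = a × b`. -/
def skew (a : V3) : Matrix (Fin 3) (Fin 3) ℝ :=
  !![0, -a 2, a 1;
     a 2, 0, -a 0;
     -a 1, a 0, 0]

/-- Physical parameters. Positions are in the body-fixed frame, whose origin is the centre of
gravity of the UAV without payload. -/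
structure Params where
  /-- gravitational acceleration -/
  g : ℝ
  /-- mass of the UAV without payload -/
  mUAV : ℝ
  /-- mass of the payload -/
  mPL : ℝ
  /-- inertia matrix of the UAV without payload -/
  HUAV : Matrix (Fin 3) (Fin 3) ℝ
  /-- inertia matrix of the payload -/
  HPL : Matrix (Fin 3) (Fin 3) ℝ
  /-- position of the point of interest -/
  rPOI : V3
  /-- position of the payload -/
  rPL : V3

/-- Euler angles `(φ, θ, ψ)` to rotation matrix (body to inertial frame), ZYX convention:
`R_z(ψ) R_y(θ) R_x(φ)`. -/
def rot (η : V3) : Matrix (Fin 3) (Fin 3) ℝ :=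
  !![Real.cos (η 2), -Real.sin (η 2), 0;
     Real.sin (η 2), Real.cos (η 2), 0;
     0, 0, 1] *
  !![Real.cos (η 1), 0, Real.sin (η 1);
     0, 1, 0;
     -Real.sin (η 1), 0, Real.cos (η 1)] *
  !![1, 0, 0;
     0, Real.cos (η 0), -Real.sin (η 0);
     0, Real.sin (η 0), Real.cos (η 0)]

/-- The matrix `Γ` with `ω = Γ η'` for the body-fixed angular velocity `ω`. -/
def Gam (η : V3) : Matrix (Fin 3) (Fin 3) ℝ :=
  !![1, 0, -Real.sin (η 1);
     0, Real.cos (η 0), Real.sin (η 0) * Real.cos (η 1);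
     0, -Real.sin (η 0), Real.cos (η 0) * Real.cos (η 1)]

/-- The partial derivatives of `rot` with respect to the three Euler angles, stacked into a
`9 × 3` matrix whose row `(i, a)` is row `a` of `∂R/∂ηᵢ`. -/
def rotPartials (η : V3) : Matrix (Fin 3 × Fin 3) (Fin 3) ℝ :=
  Matrix.of fun k b => deriv (fun s => rot (Function.update η k.1 s) k.2 b) (η k.1)

/-- States `(p', ω, p, η)`: velocity of the point of interest, body-fixed angular velocity,
position of the point of interest, Euler angles. -/
abbrev State : Type := V3 × V3 × V3 × V3

/-- Inputs `(T, τ_φ, τ_θ, τ_ψ)`: thrust and torques. -/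
abbrev Input : Type := Fin 4 → ℝ

namespace Params

variable (P : Params)

/-- Total mass. -/
def mtot : ℝ := P.mUAV + P.mPL

/-- `r̂ = r_POI - (m_PL / m_tot) r_PL`, the point of interest relative to the combined centre of
gravity, in the body-fixed frame. -/
def rhat : V3 := P.rPOI - (P.mPL / P.mtot) • P.rPL

/-- `α = z_POI - (m_PL / m_tot) z_PL`. -/
def α : ℝ := P.rPOI 2 - P.mPL / P.mtot * P.rPL 2

/-- Total inertia at the combined centre of gravity. -/
def HCoG : Matrix (Fin 3) (Fin 3) ℝ :=
  (P.mUAV * P.mPL / P.mtot) • ((skew P.rPL)ᵀ * skew P.rPL) + (P.HUAV + P.HPL)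

/-- The matrix `M₁`. -/
def M1 : Matrix (Fin 3) (Fin 3) ℝ := P.HCoG + P.mtot • ((skew P.rhat)ᵀ * skew P.rhat)

/-- The matrix `M₂`. -/
def M2 (ω : V3) : Matrix (Fin 3) (Fin 3) ℝ :=
  skew P.rhat * skew ω - skew ω * skew P.rhat

/-- The matrix `M₃ = m_tot (Γ⁻ᵀ ⊗ p'ᵀ) R_η S(r̂)`; the Kronecker product is written out. -/
def M3 (v η : V3) : Matrix (Fin 3) (Fin 3) ℝ :=
  P.mtot • ((Matrix.of fun (i : Fin 3) (k : Fin 3 × Fin 3) => ((Gam η)⁻¹)ᵀ i k.1 * v k.2) *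
    rotPartials η * skew P.rhat)

/-- The mass matrix `B_y`. -/
def By (η : V3) : Matrix (Fin 3 ⊕ Fin 3) (Fin 3 ⊕ Fin 3) ℝ :=
  Matrix.fromBlocks
    (P.mtot • (1 : Matrix (Fin 3) (Fin 3) ℝ)) (P.mtot • (rot η * skew P.rhat))
    (P.mtot • ((skew P.rhat)ᵀ * (rot η)ᵀ)) P.M1

/-- The Coriolis matrix `C_y`. -/
def Cy (v ω η : V3) : Matrix (Fin 3 ⊕ Fin 3) (Fin 3 ⊕ Fin 3) ℝ :=
  Matrix.fromBlocks
    0 (P.mtot • (rot η * skew ω * skew P.rhat))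
    (P.mtot • (P.M2 ω * (rot η)ᵀ)) (skew ω * P.M1 - P.M3 v η)

/-- The gravity vector `G_y`, from the potential energy `m_tot g e₃ᵀ (p - R r̂)`. -/
def Gy (η : V3) : Fin 3 ⊕ Fin 3 → ℝ :=
  Sum.elim ((P.mtot * P.g) • e3) ((P.mtot * P.g) • ((skew P.rhat)ᵀ *ᵥ (Gam η *ᵥ e3)))

/-- The bias vector `M₅ = C_y (p', ω) + G_y`. -/
def M5 (v ω η : V3) : Fin 3 ⊕ Fin 3 → ℝ :=
  P.Cy v ω η *ᵥ Sum.elim v ω + P.Gy η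

end Params

/-- The input matrix `M_F`: thrust along the third body axis, and torques. -/
def MF (η : V3) : Matrix (Fin 3 ⊕ Fin 3) (Fin 4) ℝ :=
  Matrix.fromRows
    !![(rot η *ᵥ e3) 0, 0, 0, 0;
       (rot η *ᵥ e3) 1, 0, 0, 0;
       (rot η *ᵥ e3) 2, 0, 0, 0]
    !![0, 1, 0, 0;
       0, 0, 1, 0;
       0, 0, 0, 1]

/-- Selects `(p'', ω_z')` from `(p'', ω')`. -/
def outSel : Matrix (Fin 4) (Fin 3 ⊕ Fin 3) ℝ :=
  Matrix.fromCols
    !![1, 0, 0;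
       0, 1, 0;
       0, 0, 1;
       0, 0, 0]
    !![0, 0, 0;
       0, 0, 0;
       0, 0, 0;
       0, 0, 1]

namespace Params

variable (P : Params)

/-- The accelerations `(p'', ω') = B_y⁻¹ (M_F F - M₅)`. -/
def accel (v ω η : V3) (F : Input) : Fin 3 ⊕ Fin 3 → ℝ :=
  (P.By η)⁻¹ *ᵥ (MF η *ᵥ F - P.M5 v ω η)

/-- The full nonlinear model `x' = f (x, F)`, with `x = (p', ω, p, η)`. -/
def model (q : State × Input) : State :=
  let v := q.1.1
  let ω := q.1.2.1
  let η := q.1.2.2.2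
  (fun i => P.accel v ω η q.2 (Sum.inl i),
   fun i => P.accel v ω η q.2 (Sum.inr i),
   v,
   (Gam η)⁻¹ *ᵥ ω)

/-- The matrix `M₄`. -/
def M4 (η : V3) : Matrix (Fin 4) (Fin 3 ⊕ Fin 3) ℝ := outSel * (P.By η)⁻¹

/-- The input-output linearizing feedback with desired value `a` of `(p'', ω_z')`. -/
def linearizingInput (v ω η : V3) (a : Fin 4 → ℝ) : Input :=
  (P.M4 η * MF η)⁻¹ *ᵥ (a + P.M4 η *ᵥ P.M5 v ω η)

/-- The vector field of the zero dynamics for the outputs `p` and `ω_z`, in the states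
`z = (ω_x, ω_y, φ, θ, ψ)`: the model with `p = p' = 0` and `ω_z = 0`, under the linearizing
feedback with desired `p'' = 0` and `ω_z' = 0`. -/
def zeroDyn (z : Fin 5 → ℝ) : Fin 5 → ℝ :=
  let ω : V3 := ![z 0, z 1, 0]
  let η : V3 := ![z 2, z 3, z 4]
  let a := P.accel 0 ω η (P.linearizingInput 0 ω η 0)
  let dη := (Gam η)⁻¹ *ᵥ ω
  ![a (Sum.inr 0), a (Sum.inr 1), dη 0, dη 1, dη 2]

/-- The Jacobian matrix of the zero dynamics at the origin. -/
def zeroDynJacobian : Matrix (Fin 5) (Fin 5) ℝ :=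
  !![0, 0, -P.g / P.α, 0, 0;
     0, 0, 0, -P.g / P.α, 0;
     1, 0, 0, 0, 0;
     0, 1, 0, 0, 0;
     0, 0, 0, 0, 0]

/-- The input that holds the hover state `x = 0`. -/
def hoverInput : Input :=
  Matrix.vecCons (P.mtot * P.g) ((P.mtot * P.g) • ((skew P.rhat)ᵀ *ᵥ e3))

/-- The output `(p, ω_z)` vanishes at the state `x`. -/
def OutputZero (x : State) : Prop := x.2.2.1 = 0 ∧ x.2.1 2 = 0

/-- The dynamics of the model linearized at hover, under the constraint that the output is
identically zero, with the (deviation of the) input free. It makes sense also for `α = 0`, where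
the linearizing feedback does not exist. -/
def constrainedLinearization (x : State) : Set State :=
  {w | OutputZero x ∧ ∃ u : Input, w = fderiv ℝ P.model (0, P.hoverInput) (x, u)}

end Params

end UAVPayload

end

/-
Rotated into the body frame, the translational half of `B_y (p'', ω') + M₅ = M_F F` reads
`m_tot (Rᵀ p'' + r̂ × ω' + ω × (r̂ × ω) + g Γ e₃) = T e₃`. Its horizontal components do not involve
the input. Hence `p'' = 0`, `ω_z' = 0` and `α ≠ 0` determine `ω'` and `T`, which makes `M₄ M_F`
invertible, and to first order at hover they become the tilt equations `α ω_x' = -g φ`,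
`α ω_y' = -g θ`, with `η' = ω`.

These are two identical oscillators and a neutral yaw angle. For `α ≥ 0` the energies
`(α / g) ω_x² + φ²` and `(α / g) ω_y² + θ²` are conserved along the constrained linearization; for
`α = 0` they reduce to `φ² = θ² = 0`, so `ω_x` and `ω_y` vanish as well. The linearized zero
dynamics embed into the constrained linearization and inherit its stability, while the equilibria
`ψ = const` exclude attractivity. For `α < 0` Chetaev's argument applies to
`V = ω_x φ + ω_y θ - ψ²`: although the yaw direction is not hyperbolic, `V' ≥ c V` near the origin,
so `V` grows exponentially along solutions that start where `V > 0`.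
-/
namespace UAVPayload

open scoped Matrix.Norms.Elementwise

/-! ### Solutions and stability -/

section Stability

variable {E : Type*} [NormedAddCommGroup E] [NormedSpace ℝ E]

theorem IsSolution.mono {F : E → Set E} {S T : ℝ} {z : ℝ → E} (hz : IsSolution F T z)
    (hST : S ≤ T) : IsSolution F S z := fun t ht =>
  have hsub : Icc 0 S ⊆ Icc 0 T := Icc_subset_Icc_right hST
  let ⟨v, hv, hder⟩ := hz t (hsub ht)
  ⟨v, hv, hder.mono hsub⟩

theorem IsSolution.map {F : E → Set E} {E' : Type*} [NormedAddCommGroup E'] [NormedSpace ℝ E']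
    {G : E' → Set E'} {L : E →L[ℝ] E'} (hL : ∀ z, ∀ v ∈ F z, L v ∈ G (L z)) {T : ℝ} {z : ℝ → E}
    (hz : IsSolution F T z) : IsSolution G T (L ∘ z) := fun t ht =>
  let ⟨v, hv, hder⟩ := hz t ht
  ⟨L v, hL _ _ hv, L.hasFDerivAt.comp_hasDerivWithinAt t hder⟩

theorem LyapunovStable.of_map {F : E → Set E} {E' : Type*} [NormedAddCommGroup E']
    [NormedSpace ℝ E'] {G : E' → Set E'} (hG : LyapunovStable G) {L : E →L[ℝ] E'}
    {K : E' →L[ℝ] E} (hKL : ∀ z, K (L z) = z) (hL : ∀ z, ∀ v ∈ F z, L v ∈ G (L z)) :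
    LyapunovStable F := by
  intro ε hε
  obtain ⟨ε', hε', hK⟩ := Metric.continuousAt_iff.1 (K.continuous.continuousAt (x := 0)) ε hε
  obtain ⟨δ', hδ', hstab⟩ := hG ε' hε'
  obtain ⟨δ, hδ, hLδ⟩ := Metric.continuousAt_iff.1 (L.continuous.continuousAt (x := 0)) δ' hδ'
  simp only [map_zero, dist_zero_right] at hK hLδ
  refine ⟨δ, hδ, fun T z hz h0 t ht => ?_⟩
  simpa [hKL] using hK (hstab T (L ∘ z) (hz.map hL) (hLδ h0) t ht)

theorem isSolution_ode {f : E → E} {T : ℝ} {z : ℝ → E} : IsSolution (ode f) T z ↔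
    ∀ t ∈ Icc 0 T, HasDerivWithinAt z (f (z t)) (Icc 0 T) t := by
  simp [IsSolution, ode]

theorem IsSolution.exists_concat {f : E → E} {S T : ℝ} {y z : ℝ → E} (hS : 0 ≤ S)
    (hT : 0 ≤ T) (hz : IsSolution (ode f) S z) (hy : IsSolution (ode f) T y) (hyz : y 0 = z S) :
    ∃ w, w 0 = z 0 ∧ IsSolution (ode f) (S + T) w := by
  rw [isSolution_ode] at hz hy
  set w : ℝ → E := fun t => if t ≤ S then z t else y (t - S) with hw
  have hwz : EqOn w z (Icc 0 S) := fun t ht => if_pos ht.2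
  have hwy : EqOn w (fun t => y (t - S)) (Icc S (S + T)) := by
    intro t ht
    rcases ht.1.eq_or_lt with rfl | hlt
    · simp [hw, hyz]
    · exact if_neg hlt.not_ge
  refine ⟨w, hwz (left_mem_Icc.2 hS), isSolution_ode.2 fun t _ => ?_⟩
  rw [← Icc_union_Icc_eq_Icc hS (le_add_of_nonneg_right hT)]
  have hleft : HasDerivWithinAt w (f (w t)) (Icc 0 S) t := by
    by_cases htS : t ∈ Icc 0 S
    · exact hwz htS ▸ (hz t htS).congr_of_mem hwz htS
    · exact HasFDerivWithinAt.of_notMem_closure (by rwa [closure_Icc])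
  have hright : HasDerivWithinAt w (f (w t)) (Icc S (S + T)) t := by
    by_cases htS : t ∈ Icc S (S + T)
    · have hmaps : MapsTo (fun s => s - S) (Icc S (S + T)) (Icc 0 T) := fun s hs =>
        ⟨sub_nonneg.2 hs.1, sub_le_iff_le_add'.2 hs.2⟩
      have h := (hy _ (hmaps htS)).scomp t ((hasDerivWithinAt_id t _).sub_const S) hmaps
      rw [one_smul] at h
      exact hwy htS ▸ h.congr_of_mem hwy htS
    · exact HasFDerivWithinAt.of_notMem_closure (by rwa [closure_Icc])
  exact hleft.union hright

theorem LyapunovStable.exists_isSolution [CompleteSpace E] {f : E → E} (hf : ContDiffAt ℝ 1 f 0)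
    (hs : LyapunovStable (ode f)) :
    ∃ δ > 0, ∀ x, ‖x‖ < δ → ∀ T, ∃ z, z 0 = x ∧ IsSolution (ode f) T z := by
  obtain ⟨r, hr, τ, hτ, hloc⟩ :=
    hf.exists_forall_mem_closedBall_exists_eq_forall_mem_Ioo_hasDerivAt 0
  have hshort (x : E) (hx : ‖x‖ < r) : ∃ y, y 0 = x ∧ IsSolution (ode f) (τ / 2) y := by
    obtain ⟨y, hy0, hy⟩ := hloc x (by simpa using hx.le)
    refine ⟨y, hy0, isSolution_ode.2 fun t ht => (hy t ⟨?_, ?_⟩).hasDerivWithinAt⟩ <;>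
      linarith [ht.1, ht.2]
  obtain ⟨δ, hδ, hstab⟩ := hs r hr
  refine ⟨δ, hδ, fun x hx T => ?_⟩
  have hlong (n : ℕ) : ∃ z, z 0 = x ∧ IsSolution (ode f) (n * (τ / 2)) z := by
    induction n with
    | zero =>
      exact ⟨fun _ => x, rfl, isSolution_ode.2 fun t _ =>
        HasFDerivWithinAt.of_subsingleton (by simp)⟩
    | succ n ih =>
      obtain ⟨z, rfl, hz⟩ := ih
      have hn : 0 ≤ n * (τ / 2) := by positivity
      obtain ⟨y, hy0, hy⟩ := hshort _ (hstab _ z hz hx _ (right_mem_Icc.2 hn))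
      rw [Nat.cast_succ, add_one_mul]
      exact hz.exists_concat hn (by positivity) hy hy0
  obtain ⟨n, hn⟩ := exists_nat_ge (T / (τ / 2))
  obtain ⟨z, hz0, hz⟩ := hlong n
  exact ⟨z, hz0, hz.mono ((div_le_iff₀ (by positivity)).1 hn)⟩

theorem mul_exp_le_of_mul_le_deriv {u u' : ℝ → ℝ} {c T : ℝ} (hT : 0 ≤ T)
    (hu : ∀ t ∈ Icc 0 T, HasDerivWithinAt u (u' t) (Icc 0 T) t)
    (hle : ∀ t ∈ Icc 0 T, c * u t ≤ u' t) : u 0 * Real.exp (c * T) ≤ u T := by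
  have hder (t : ℝ) (ht : t ∈ Icc 0 T) : HasDerivWithinAt (fun t => u t * Real.exp (-c * t))
      (u' t * Real.exp (-c * t) + u t * (Real.exp (-c * t) * -c)) (Icc 0 T) t := by
    have hexp := ((hasDerivAt_id t).const_mul (-c)).exp.hasDerivWithinAt (s := Icc 0 T)
    rw [mul_one] at hexp
    exact (hu t ht).mul hexp
  have hmono : MonotoneOn (fun t => u t * Real.exp (-c * t)) (Icc 0 T) := by
    refine monotoneOn_of_hasDerivWithinAt_nonneg (convex_Icc 0 T)
      (fun t ht => (hder t ht).continuousWithinAt)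
      (fun t ht => (hder t (interior_subset ht)).mono interior_subset) fun t ht => ?_
    have h := mul_nonneg (sub_nonneg.2 (hle t (interior_subset ht))) (Real.exp_pos (-c * t)).le
    linarith
  have h := hmono (left_mem_Icc.2 hT) (right_mem_Icc.2 hT) hT
  simp only [mul_zero, Real.exp_zero, mul_one, neg_mul, Real.exp_neg] at h
  rwa [le_mul_inv_iff₀ (Real.exp_pos _)] at h

/- The quadratic margin `ε ‖x‖ ^ 2` in the linear inequality absorbs the remainder of `f`. -/
theorem eventually_mul_le_of_hasFDerivAt {f : E → E} {A : E →L[ℝ] E} (hA : HasFDerivAt f A 0)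
    (h0 : f 0 = 0) {B : E →L[ℝ] E →L[ℝ] ℝ} {c ε : ℝ} (hε : 0 < ε)
    (hB : ∀ x, c * B x x + ε * ‖x‖ ^ 2 ≤ B x (A x) + B (A x) x) :
    ∀ᶠ x in 𝓝 0, c * B x x ≤ B x (f x) + B (f x) x := by
  have hη : 0 < ε / (2 * ‖B‖ + 1) := by positivity
  filter_upwards [hA.isLittleO.def hη] with x hx
  rw [h0, sub_zero, sub_zero] at hx
  set d := f x - A x with hd
  have hfx : f x = A x + d := by rw [hd, add_sub_cancel]
  have hxd : |B x d| ≤ ‖B‖ * ‖x‖ * ‖d‖ := B.le_opNorm₂ x d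
  have hdx : |B d x| ≤ ‖B‖ * ‖d‖ * ‖x‖ := B.le_opNorm₂ d x
  have herr : 2 * ‖B‖ * ‖x‖ * ‖d‖ ≤ ε * ‖x‖ ^ 2 := by
    rw [div_mul_eq_mul_div, le_div_iff₀ (by positivity)] at hx
    nlinarith [norm_nonneg x, norm_nonneg d, mul_le_mul_of_nonneg_left hx (norm_nonneg x)]
  rw [hfx, map_add, ContinuousLinearMap.map_add₂]
  linarith [hB x, (abs_le.1 hxd).1, (abs_le.1 hdx).1]

theorem unstable_ode_of_bilinear [CompleteSpace E] {f : E → E} (hf : ContDiffAt ℝ 1 f 0)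
    {A : E →L[ℝ] E} (hA : HasFDerivAt f A 0) (h0 : f 0 = 0) {B : E →L[ℝ] E →L[ℝ] ℝ} {c ε : ℝ}
    (hc : 0 < c) (hε : 0 < ε) (hB : ∀ x, c * B x x + ε * ‖x‖ ^ 2 ≤ B x (A x) + B (A x) x)
    {x₀ : E} (hx₀ : 0 < B x₀ x₀) : Unstable (ode f) := by
  intro hs
  obtain ⟨r, hr, hV⟩ := Metric.eventually_nhds_iff.1 (eventually_mul_le_of_hasFDerivAt hA h0 hε hB)
  obtain ⟨δ₁, hδ₁, hstab⟩ := hs r hr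
  obtain ⟨δ₂, hδ₂, hsol⟩ := hs.exists_isSolution hf
  obtain ⟨x, hx, hxB⟩ : ∃ x, ‖x‖ < min δ₁ δ₂ ∧ 0 < B x x := by
    have hsmall : Tendsto (fun s : ℝ => ‖s • x₀‖) (𝓝[>] 0) (𝓝 0) := by
      have : Continuous fun s : ℝ => ‖s • x₀‖ := by fun_prop
      simpa using this.continuousWithinAt.tendsto (x := 0) (s := Ioi 0)
    obtain ⟨s, hs, hs0⟩ := ((hsmall.eventually_lt_const (lt_min hδ₁ hδ₂)).and
      self_mem_nhdsWithin).exists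
    refine ⟨s • x₀, hs, ?_⟩
    simpa using mul_pos hs0 (mul_pos hs0 hx₀)
  set T := ‖B‖ * r ^ 2 / (c * B x x)
  have hT : 0 ≤ T := by positivity
  obtain ⟨z, rfl, hz⟩ := hsol x (lt_min_iff.1 hx).2 T
  have hzr := hstab T z hz (lt_min_iff.1 hx).1
  rw [isSolution_ode] at hz
  have hgrowth := mul_exp_le_of_mul_le_deriv (u := fun t => B (z t) (z t)) hT
    (fun t ht => (B.hasFDerivAt.comp_hasDerivWithinAt t (hz t ht)).clm_apply (hz t ht))
    (fun t ht => by
      rw [add_comm]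
      exact hV (by simpa using hzr t ht))
  have hbound : B (z T) (z T) ≤ ‖B‖ * r ^ 2 := by
    have hzT : ‖z T‖ ≤ r := (hzr T (right_mem_Icc.2 hT)).le
    calc B (z T) (z T) ≤ ‖B‖ * ‖z T‖ * ‖z T‖ := (le_abs_self _).trans (B.le_opNorm₂ _ _)
      _ = ‖B‖ * ‖z T‖ ^ 2 := by ring
      _ ≤ ‖B‖ * r ^ 2 := by gcongr
  have hcT : B (z 0) (z 0) * (c * T) = ‖B‖ * r ^ 2 := by
    simp only [T]
    field_simp
  nlinarith [Real.add_one_le_exp (c * T)]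

theorem sq_norm_le_sum_sq {ι : Type*} [Fintype ι] (x : ι → ℝ) : ‖x‖ ^ 2 ≤ ∑ i, x i ^ 2 := by
  have hsum : 0 ≤ ∑ i, x i ^ 2 := Finset.sum_nonneg fun i _ => sq_nonneg (x i)
  rw [← Real.le_sqrt (norm_nonneg x) hsum]
  refine (pi_norm_le_iff_of_nonneg (Real.sqrt_nonneg _)).2 fun i => Real.abs_le_sqrt ?_
  exact Finset.single_le_sum (f := fun i => x i ^ 2) (fun i _ => sq_nonneg _) (Finset.mem_univ i)

theorem lyapunovStable_of_norm_le {F : E → Set E} {C : ℝ}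
    (h : ∀ T > 0, ∀ z, IsSolution F T z → ∀ t ∈ Icc 0 T, ‖z t‖ ≤ C * ‖z 0‖) :
    LyapunovStable F := by
  intro ε hε
  refine ⟨ε / (|C| + 1), by positivity, fun T z hz h0 t ht => ?_⟩
  rw [lt_div_iff₀ (by positivity)] at h0
  rcases ht.1.eq_or_lt with rfl | ht0
  · nlinarith [norm_nonneg (z 0), abs_nonneg C]
  · have hzt := h T (ht0.trans_le ht.2) z hz t ht
    nlinarith [norm_nonneg (z 0), le_abs_self C]

theorem not_attractive_of_zero_mem {F : E → Set E} {e : E} (he : e ≠ 0)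
    (hF : ∀ s : ℝ, (0 : E) ∈ F (s • e)) :
    ¬ Attractive F := by
  rintro ⟨δ, hδ, h⟩
  have hsmall : ∀ᶠ s : ℝ in 𝓝[>] 0, ‖s • e‖ < δ := by
    have hcont : Continuous fun s : ℝ => ‖s • e‖ := by fun_prop
    exact hcont.continuousWithinAt.eventually_lt_const (by simpa)
  obtain ⟨s, hs, hs0⟩ := (hsmall.and self_mem_nhdsWithin).exists
  have hconst := h (fun _ => s • e)
    (fun T t _ => ⟨0, hF s, hasDerivWithinAt_const t _ _⟩) hs
  exact smul_ne_zero (ne_of_gt hs0) he (tendsto_nhds_unique tendsto_const_nhds hconst)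

end Stability

section Oscillator

variable {E : Type*} [NormedAddCommGroup E] [NormedSpace ℝ E] {T : ℝ}

theorem eq_of_hasDerivWithinAt_zero {f : ℝ → E}
    (hf : ∀ t ∈ Icc 0 T, HasDerivWithinAt f 0 (Icc 0 T) t) : ∀ t ∈ Icc 0 T, f t = f 0 :=
  constant_of_derivWithin_zero (fun t ht => (hf t ht).differentiableWithinAt) fun t ht =>
    (hf t (Ico_subset_Icc_self ht)).derivWithin
      (uniqueDiffOn_Icc (ht.1.trans_lt ht.2) t (Ico_subset_Icc_self ht))

theorem eq_zero_of_hasDerivWithinAt_of_eqOn_zero (hT : 0 < T) {f : ℝ → E} {t : ℝ} {f' : E}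
    (ht : t ∈ Icc 0 T) (hf : HasDerivWithinAt f f' (Icc 0 T) t)
    (h0 : ∀ s ∈ Icc 0 T, f s = 0) : f' = 0 :=
  (uniqueDiffOn_Icc hT t ht).eq_deriv _ hf
    ((hasDerivWithinAt_const t _ 0).congr_of_mem h0 ht)

theorem oscillator_energy_eq {κ : ℝ} {w w' φ : ℝ → ℝ}
    (hw : ∀ t ∈ Icc 0 T, HasDerivWithinAt w (w' t) (Icc 0 T) t)
    (hφ : ∀ t ∈ Icc 0 T, HasDerivWithinAt φ (w t) (Icc 0 T) t)
    (hosc : ∀ t ∈ Icc 0 T, κ * w' t = -φ t) :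
    ∀ t ∈ Icc 0 T, κ * w t ^ 2 + φ t ^ 2 = κ * w 0 ^ 2 + φ 0 ^ 2 := by
  refine eq_of_hasDerivWithinAt_zero (f := fun t => κ * w t ^ 2 + φ t ^ 2) fun t ht => ?_
  refine (((hw t ht).pow 2).const_mul κ).add ((hφ t ht).pow 2) |>.congr_deriv ?_
  simp only [Nat.cast_ofNat, Nat.add_one_sub_one, pow_one]
  linear_combination 2 * w t * hosc t ht

/- For `κ = 0` the constant is `1`, since `0⁻¹ = 0`, and `w` and `φ` vanish. -/
theorem abs_le_of_oscillator (hT : 0 < T) {κ r : ℝ} (hκ : 0 ≤ κ) {w w' φ : ℝ → ℝ}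
    (hw : ∀ t ∈ Icc 0 T, HasDerivWithinAt w (w' t) (Icc 0 T) t)
    (hφ : ∀ t ∈ Icc 0 T, HasDerivWithinAt φ (w t) (Icc 0 T) t)
    (hosc : ∀ t ∈ Icc 0 T, κ * w' t = -φ t) (hw0 : |w 0| ≤ r) (hφ0 : |φ 0| ≤ r) :
    ∀ t ∈ Icc 0 T, |w t| ≤ (1 + κ + κ⁻¹) * r ∧ |φ t| ≤ (1 + κ + κ⁻¹) * r := by
  intro t ht
  have hr : 0 ≤ r := (abs_nonneg _).trans hw0
  have hκ' : 0 ≤ κ⁻¹ := inv_nonneg.2 hκ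
  have hC : 0 ≤ (1 + κ + κ⁻¹) * r := by positivity
  have henergy : κ * w t ^ 2 + φ t ^ 2 ≤ (κ + 1) * r ^ 2 := by
    rw [oscillator_energy_eq hw hφ hosc t ht]
    have := mul_le_mul_of_nonneg_left (sq_le_sq.2 (hw0.trans (le_abs_self r))) hκ
    linarith [sq_le_sq.2 (hφ0.trans (le_abs_self r))]
  have hsq {a b : ℝ} (h : a ^ 2 ≤ b * r ^ 2) (hb : b ≤ (1 + κ + κ⁻¹) ^ 2) :
      |a| ≤ (1 + κ + κ⁻¹) * r := by
    refine abs_le_of_sq_le_sq (h.trans ?_) hC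
    rw [mul_pow]
    gcongr
  refine ⟨?_, hsq (b := κ + 1) (by nlinarith [sq_nonneg (w t)]) (by nlinarith)⟩
  rcases hκ.eq_or_lt with rfl | hκ
  · have hwt : w t = 0 := eq_zero_of_hasDerivWithinAt_of_eqOn_zero hT ht (hφ t ht)
      fun s hs => by simpa using hosc s hs
    rwa [hwt, abs_zero]
  · refine hsq (b := 1 + κ⁻¹) ?_ (by nlinarith)
    have hφt := sq_nonneg (φ t)
    calc w t ^ 2 = κ⁻¹ * (κ * w t ^ 2) := by field_simp
      _ ≤ κ⁻¹ * ((κ + 1) * r ^ 2) := mul_le_mul_of_nonneg_left (by linarith) hκ'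
      _ = (1 + κ⁻¹) * r ^ 2 := by field_simp

end Oscillator

/-! ### Smoothness of matrix-valued functions -/

section MatrixCalculus

variable {𝕜 E F R l m n o : Type*} [NontriviallyNormedField 𝕜] [NormedAddCommGroup E]
  [NormedSpace 𝕜 E] [NormedAddCommGroup F] [NormedSpace 𝕜 F] [Fintype l] [Fintype m] [Fintype n]
  [Fintype o] {k : WithTop ℕ∞} {x : E}

theorem contDiffAt_matrix {A : E → Matrix m n F} :
    ContDiffAt 𝕜 k A x ↔ ∀ i j, ContDiffAt 𝕜 k (fun y => A y i j) x :=
  contDiffAt_pi.trans (forall_congr' fun _ => contDiffAt_pi)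

@[fun_prop]
theorem contDiffAt_matrix_of {A : E → m → n → F} (hA : ContDiffAt 𝕜 k A x) :
    ContDiffAt 𝕜 k (fun y => Matrix.of (A y)) x :=
  hA

@[fun_prop]
theorem contDiffAt_matrix_transpose {A : E → Matrix m n F} (hA : ContDiffAt 𝕜 k A x) :
    ContDiffAt 𝕜 k (fun y => (A y)ᵀ) x :=
  contDiffAt_matrix.2 fun i j => contDiffAt_matrix.1 hA j i

@[fun_prop]
theorem contDiffAt_vecCons {d : ℕ} {a : E → F} {b : E → Fin d → F}
    (ha : ContDiffAt 𝕜 k a x) (hb : ContDiffAt 𝕜 k b x) :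
    ContDiffAt 𝕜 k (fun y => Matrix.vecCons (a y) (b y)) x :=
  contDiffAt_pi.2 (Fin.cases ha (contDiffAt_pi.1 hb))

@[fun_prop]
theorem contDiffAt_sumElim {a : E → l → F} {b : E → m → F} (ha : ContDiffAt 𝕜 k a x)
    (hb : ContDiffAt 𝕜 k b x) : ContDiffAt 𝕜 k (fun y => Sum.elim (a y) (b y)) x := by
  rw [contDiffAt_pi] at *
  rintro (i | i)
  exacts [ha i, hb i]

@[fun_prop]
theorem contDiffAt_fromRows {A : E → Matrix l n F} {B : E → Matrix m n F}
    (hA : ContDiffAt 𝕜 k A x) (hB : ContDiffAt 𝕜 k B x) :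
    ContDiffAt 𝕜 k (fun y => Matrix.fromRows (A y) (B y)) x := by
  rw [contDiffAt_matrix] at *
  rintro (i | i) j
  exacts [hA i j, hB i j]

@[fun_prop]
theorem contDiffAt_fromBlocks {A : E → Matrix n l F} {B : E → Matrix n m F} {C : E → Matrix o l F}
    {D : E → Matrix o m F} (hA : ContDiffAt 𝕜 k A x) (hB : ContDiffAt 𝕜 k B x)
    (hC : ContDiffAt 𝕜 k C x) (hD : ContDiffAt 𝕜 k D x) :
    ContDiffAt 𝕜 k (fun y => Matrix.fromBlocks (A y) (B y) (C y) (D y)) x := by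
  rw [contDiffAt_matrix] at *
  rintro (i | i) (j | j)
  exacts [hA i j, hB i j, hC i j, hD i j]

@[fun_prop]
theorem contDiffAt_matrix_mul [NormedRing R] [NormedAlgebra 𝕜 R] {A : E → Matrix l m R}
    {B : E → Matrix m n R} (hA : ContDiffAt 𝕜 k A x) (hB : ContDiffAt 𝕜 k B x) :
    ContDiffAt 𝕜 k (fun y => A y * B y) x :=
  contDiffAt_matrix.2 fun i j => by
    simp only [Matrix.mul_apply]
    exact .sum fun p _ => (contDiffAt_matrix.1 hA i p).mul (contDiffAt_matrix.1 hB p j)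

@[fun_prop]
theorem contDiffAt_matrix_mulVec [NormedRing R] [NormedAlgebra 𝕜 R] {A : E → Matrix m n R}
    {v : E → n → R} (hA : ContDiffAt 𝕜 k A x) (hv : ContDiffAt 𝕜 k v x) :
    ContDiffAt 𝕜 k (fun y => A y *ᵥ v y) x :=
  contDiffAt_pi.2 fun i => by
    simp only [Matrix.mulVec, dotProduct]
    exact .sum fun p _ => (contDiffAt_matrix.1 hA i p).mul (contDiffAt_pi.1 hv p)

theorem contDiffAt_matrix_det [DecidableEq n] [NormedCommRing R] [NormedAlgebra 𝕜 R]
    {A : E → Matrix n n R} (hA : ContDiffAt 𝕜 k A x) :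
    ContDiffAt 𝕜 k (fun y => (A y).det) x := by
  simp only [Matrix.det_apply, Units.smul_def, ← Int.cast_smul_eq_zsmul 𝕜]
  exact .sum fun σ _ => (contDiffAt_prod fun i _ => contDiffAt_matrix.1 hA _ i).const_smul _

theorem contDiffAt_matrix_inv [DecidableEq n] [NormedField R] [NormedAlgebra 𝕜 R]
    {A : E → Matrix n n R} (hA : ContDiffAt 𝕜 k A x) (hx : IsUnit (A x).det) :
    ContDiffAt 𝕜 k (fun y => (A y)⁻¹) x := by
  simp only [Matrix.inv_def, Ring.inverse_eq_inv']
  refine ((contDiffAt_matrix_det hA).inv hx.ne_zero).smul (contDiffAt_matrix.2 fun i j => ?_)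
  simp only [Matrix.adjugate_apply]
  refine contDiffAt_matrix_det (contDiffAt_matrix.2 fun p q => ?_)
  by_cases hp : p = j
  · simpa only [hp, Matrix.updateRow_self] using contDiffAt_const
  · simpa only [Matrix.updateRow_ne hp] using contDiffAt_matrix.1 hA p q

theorem hasDerivAt_matrix_mulVec_of_eq_zero {p : Type*} [NormedRing R] [NormedAlgebra 𝕜 R]
    {A : 𝕜 → Matrix p n R} {v : 𝕜 → n → R} {v' : n → R} {t : 𝕜} (hA : DifferentiableAt 𝕜 A t)
    (hv : HasDerivAt v v' t) (hvt : v t = 0) :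
    HasDerivAt (fun s => A s *ᵥ v s) (A t *ᵥ v') t := by
  refine hasDerivAt_pi.2 fun i => ?_
  have hAij (j : n) : DifferentiableAt 𝕜 (fun s => A s i j) t :=
    differentiableAt_pi.1 (differentiableAt_pi.1 hA i) j
  simpa [Matrix.mulVec, dotProduct, hvt] using HasDerivAt.fun_sum fun j (_ : j ∈ Finset.univ) =>
    (hAij j).hasDerivAt.mul (hasDerivAt_pi.1 hv j)

end MatrixCalculus

/-! ### Algebra of the model -/

theorem skew_mulVec (a b : V3) : skew a *ᵥ b =
    ![a 1 * b 2 - a 2 * b 1, a 2 * b 0 - a 0 * b 2, a 0 * b 1 - a 1 * b 0] := by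
  ext i
  fin_cases i <;> simp [skew, Matrix.mulVec, dotProduct, Fin.sum_univ_three] <;> ring

theorem eq_zero_of_skew_mulVec_eq_smul_e3 {r w : V3} {c : ℝ} (hr : r 2 ≠ 0) (hw : w 2 = 0)
    (h : skew r *ᵥ w = c • e3) : w = 0 ∧ c = 0 := by
  rw [skew_mulVec] at h
  have hw1 : w 1 = 0 := by simpa [e3, hw, hr] using congrFun h 0
  have hw0 : w 0 = 0 := by simpa [e3, hw, hr] using congrFun h 1
  have hc : c = 0 := by simpa [e3, hw0, hw1] using (congrFun h 2).symm
  refine ⟨?_, hc⟩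
  ext i
  fin_cases i
  exacts [hw0, hw1, hw]

theorem rot_mem_orthogonalGroup (η : V3) : rot η ∈ Matrix.orthogonalGroup (Fin 3) ℝ := by
  refine mul_mem (mul_mem ?_ ?_) ?_ <;> rw [Matrix.mem_orthogonalGroup_iff'] <;> ext i j <;>
    fin_cases i <;> fin_cases j <;>
    simp [Matrix.mul_apply, Fin.sum_univ_three, ← sq, mul_comm]

theorem rot_transpose_mul_rot (η : V3) : (rot η)ᵀ * rot η = 1 :=
  (Matrix.mem_orthogonalGroup_iff' _ _).1 (rot_mem_orthogonalGroup η)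

theorem rot_transpose_mulVec_rot_mulVec (η a : V3) : (rot η)ᵀ *ᵥ (rot η *ᵥ a) = a := by
  rw [Matrix.mulVec_mulVec, rot_transpose_mul_rot, Matrix.one_mulVec]

theorem rot_transpose_mulVec_e3 (η : V3) : (rot η)ᵀ *ᵥ e3 = Gam η *ᵥ e3 := by
  ext i
  fin_cases i <;>
    simp [rot, Gam, e3, Matrix.mulVec, dotProduct, Fin.sum_univ_three, mul_comm]

theorem rot_mulVec_e3_of_level (ψ : ℝ) : rot ![0, 0, ψ] *ᵥ e3 = e3 := by
  ext i
  fin_cases i <;> simp [rot, e3, Matrix.mulVec, dotProduct, Matrix.mul_apply, Fin.sum_univ_three]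

theorem Gam_mulVec_e3 (η : V3) : Gam η *ᵥ e3 =
    ![-Real.sin (η 1), Real.sin (η 0) * Real.cos (η 1), Real.cos (η 0) * Real.cos (η 1)] := by
  ext i
  fin_cases i <;> simp [Gam, e3, Matrix.mulVec, dotProduct, Fin.sum_univ_three]

theorem Gam_mulVec_e3_of_level (ψ : ℝ) : Gam ![0, 0, ψ] *ᵥ e3 = e3 := by
  rw [Gam_mulVec_e3]
  simp [e3]

theorem det_Gam (η : V3) : (Gam η).det = Real.cos (η 1) := by
  simp only [Gam, Matrix.det_fin_three, Matrix.of_apply, Matrix.cons_val]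
  linear_combination Real.cos (η 1) * Real.sin_sq_add_cos_sq (η 0)

theorem Gam_zero : Gam 0 = 1 := by
  ext i j
  fin_cases i <;> fin_cases j <;> simp [Gam]

theorem rot_zero : rot 0 = 1 := by
  ext i j
  fin_cases i <;> fin_cases j <;> simp [rot, Matrix.mul_apply, Fin.sum_univ_three]

theorem MF_mulVec (η : V3) (F : Input) :
    MF η *ᵥ F = Sum.elim (F 0 • (rot η *ᵥ e3)) (Matrix.vecTail F) := by
  ext i
  rcases i with i | i <;> fin_cases i <;>
    simp [MF, Matrix.mulVec, dotProduct, Fin.sum_univ_four, Matrix.vecTail, mul_comm]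

theorem outSel_mulVec (y : Fin 3 ⊕ Fin 3 → ℝ) :
    outSel *ᵥ y = ![y (Sum.inl 0), y (Sum.inl 1), y (Sum.inl 2), y (Sum.inr 2)] := by
  ext i
  fin_cases i <;> simp [outSel, Matrix.mulVec, dotProduct, Fin.sum_univ_three]

theorem outSel_mulVec_eq_zero_iff {y : Fin 3 ⊕ Fin 3 → ℝ} :
    outSel *ᵥ y = 0 ↔ y ∘ Sum.inl = 0 ∧ y (Sum.inr 2) = 0 := by
  simp [outSel_mulVec, funext_iff, Fin.forall_fin_succ, and_assoc]

namespace Params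
variable {P : Params}

theorem rhat_two (P : Params) : P.rhat 2 = P.α := by
  simp [rhat, α]

/-- Nonvanishing of the total mass and of the determinant of the total inertia at the combined
centre of gravity; this is what makes the mass matrix `By` invertible at every attitude. -/
structure Nondegenerate (P : Params) : Prop where
  mtot_ne_zero : P.mtot ≠ 0
  isUnit_det_HCoG : IsUnit P.HCoG.det

theorem det_By (hm : P.mtot ≠ 0) (η : V3) : (P.By η).det = P.mtot ^ 3 * P.HCoG.det := by
  have hinv : (P.mtot • (1 : Matrix (Fin 3) (Fin 3) ℝ)) * (P.mtot⁻¹ • 1) = 1 := by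
    rw [smul_mul_smul_comm, mul_inv_cancel₀ hm, one_smul, one_mul]
  let _ := invertibleOfRightInverse _ _ hinv
  have hschur : P.M1 - P.mtot • ((skew P.rhat)ᵀ * (rot η)ᵀ) *
      ⅟(P.mtot • (1 : Matrix (Fin 3) (Fin 3) ℝ)) * (P.mtot • (rot η * skew P.rhat)) = P.HCoG := by
    rw [invOf_eq_right_inv hinv, smul_mul_smul_comm, mul_inv_cancel₀ hm, one_smul, Matrix.mul_one,
      Matrix.mul_smul, Matrix.mul_assoc, ← Matrix.mul_assoc (rot η)ᵀ, rot_transpose_mul_rot,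
      Matrix.one_mul, M1, add_sub_cancel_right]
  rw [By, Matrix.det_fromBlocks₁₁, hschur, Matrix.det_smul, Matrix.det_one, mul_one,
    Fintype.card_fin]

theorem Nondegenerate.isUnit_det_By (hP : P.Nondegenerate) (η : V3) : IsUnit (P.By η).det := by
  rw [det_By hP.mtot_ne_zero]
  exact (hP.mtot_ne_zero.isUnit.pow 3).mul hP.isUnit_det_HCoG

theorem nondegenerate_of_posDef (hmU : 0 < P.mUAV) (hmP : 0 ≤ P.mPL)
    (hHU : P.HUAV.PosDef) (hHP : P.HPL.PosSemidef) : P.Nondegenerate := by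
  have hm : 0 < P.mtot := add_pos_of_pos_of_nonneg hmU hmP
  have hS : ((P.mUAV * P.mPL / P.mtot) • ((skew P.rPL)ᵀ * skew P.rPL)).PosSemidef :=
    (Matrix.posSemidef_conjTranspose_mul_self (skew P.rPL)).smul (by positivity)
  exact ⟨hm.ne', (Matrix.PosDef.posSemidef_add hS (hHU.add_posSemidef hHP)).det_pos.ne'.isUnit⟩

theorem rot_transpose_mulVec_By_mulVec (η : V3) (y : Fin 3 ⊕ Fin 3 → ℝ) :
    (rot η)ᵀ *ᵥ ((P.By η *ᵥ y) ∘ Sum.inl) =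
      P.mtot • ((rot η)ᵀ *ᵥ (y ∘ Sum.inl) + skew P.rhat *ᵥ (y ∘ Sum.inr)) := by
  simp only [By, Matrix.fromBlocks_mulVec, Sum.elim_comp_inl, Matrix.smul_mulVec,
    Matrix.one_mulVec, ← Matrix.mulVec_mulVec, ← smul_add, Matrix.mulVec_smul, Matrix.mulVec_add,
    rot_transpose_mulVec_rot_mulVec]

theorem rot_transpose_mulVec_MF_mulVec (η : V3) (F : Input) :
    (rot η)ᵀ *ᵥ ((MF η *ᵥ F) ∘ Sum.inl) = F 0 • e3 := by
  rw [MF_mulVec, Sum.elim_comp_inl, Matrix.mulVec_smul, rot_transpose_mulVec_rot_mulVec]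

theorem rot_transpose_mulVec_M5 (v ω η : V3) : (rot η)ᵀ *ᵥ (P.M5 v ω η ∘ Sum.inl) =
    P.mtot • (skew ω *ᵥ (skew P.rhat *ᵥ ω) + P.g • (Gam η *ᵥ e3)) := by
  rw [M5, Pi.add_comp]
  simp only [Cy, Gy, Matrix.fromBlocks_mulVec, Sum.elim_comp_inl, Sum.elim_comp_inr,
    Matrix.zero_mulVec, zero_add, Matrix.smul_mulVec, ← Matrix.mulVec_mulVec, Matrix.mulVec_add,
    Matrix.mulVec_smul, rot_transpose_mulVec_rot_mulVec, rot_transpose_mulVec_e3, smul_add,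
    smul_smul]

namespace Nondegenerate

theorem By_mulVec_accel (hP : P.Nondegenerate) (v ω η : V3) (F : Input) :
    P.By η *ᵥ P.accel v ω η F = MF η *ᵥ F - P.M5 v ω η := by
  rw [accel, Matrix.mulVec_mulVec, Matrix.mul_nonsing_inv _ (hP.isUnit_det_By η),
    Matrix.one_mulVec]

theorem body_force_balance (hP : P.Nondegenerate) (v ω η : V3) (F : Input) :
    P.mtot • ((rot η)ᵀ *ᵥ (P.accel v ω η F ∘ Sum.inl) +
        skew P.rhat *ᵥ (P.accel v ω η F ∘ Sum.inr)) =
      F 0 • e3 - P.mtot • (skew ω *ᵥ (skew P.rhat *ᵥ ω) + P.g • (Gam η *ᵥ e3)) := by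
  rw [← rot_transpose_mulVec_By_mulVec, hP.By_mulVec_accel, Pi.sub_comp, Matrix.mulVec_sub,
    rot_transpose_mulVec_MF_mulVec, rot_transpose_mulVec_M5]

theorem isUnit_det_M4_mul_MF (hP : P.Nondegenerate) (hα : P.α ≠ 0) (η : V3) :
    IsUnit (P.M4 η * MF η).det := by
  rw [isUnit_iff_ne_zero, ne_eq, ← Matrix.exists_mulVec_eq_zero_iff.not]
  rintro ⟨F, hF, h0⟩
  rw [M4, Matrix.mul_assoc, ← Matrix.mulVec_mulVec, outSel_mulVec_eq_zero_iff] at h0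
  set y := ((P.By η)⁻¹ * MF η) *ᵥ F with hy
  obtain ⟨hlin, hyaw⟩ := h0
  have hBy : P.By η *ᵥ y = MF η *ᵥ F := by
    rw [hy, Matrix.mulVec_mulVec, Matrix.mul_nonsing_inv_cancel_left _ _ (hP.isUnit_det_By η)]
  have hthrust : skew P.rhat *ᵥ (P.mtot • (y ∘ Sum.inr)) = F 0 • e3 := by
    rw [← rot_transpose_mulVec_MF_mulVec η, ← hBy, rot_transpose_mulVec_By_mulVec, hlin,
      Matrix.mulVec_zero, zero_add, Matrix.mulVec_smul]
  obtain ⟨hrot, hF0⟩ : P.mtot • (y ∘ Sum.inr) = 0 ∧ F 0 = 0 :=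
    eq_zero_of_skew_mulVec_eq_smul_e3 (by rwa [rhat_two]) (by simp [hyaw]) hthrust
  have hy0 : y = 0 := by
    rw [← Sum.elim_comp_inl_inr y, hlin, (smul_eq_zero_iff_right hP.mtot_ne_zero).1 hrot,
      Sum.elim_zero_zero]
  rw [hy0, Matrix.mulVec_zero, MF_mulVec] at hBy
  exact hF (funext (Fin.cases hF0 fun j => (congrFun hBy (Sum.inr j)).symm))

end Nondegenerate

theorem outSel_mulVec_accel_linearizingInput (η : V3) (hη : IsUnit (P.M4 η * MF η).det)
    (v ω : V3) (a : Fin 4 → ℝ) :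
    outSel *ᵥ P.accel v ω η (P.linearizingInput v ω η a) = a := by
  rw [accel, Matrix.mulVec_mulVec, ← M4, Matrix.mulVec_sub, linearizingInput,
    Matrix.mulVec_mulVec, Matrix.mulVec_mulVec, Matrix.mul_nonsing_inv _ hη,
    Matrix.one_mulVec, add_sub_cancel_right]

theorem MF_mulVec_hoverInput (ψ : ℝ) : MF ![0, 0, ψ] *ᵥ P.hoverInput = P.M5 0 0 ![0, 0, ψ] := by
  rw [MF_mulVec, M5, Sum.elim_zero_zero, Matrix.mulVec_zero, zero_add, Gy,
    Gam_mulVec_e3_of_level, rot_mulVec_e3_of_level, hoverInput, Matrix.tail_cons,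
    Matrix.cons_val_zero]

theorem accel_hover (ψ : ℝ) : P.accel 0 0 ![0, 0, ψ] P.hoverInput = 0 := by
  rw [accel, MF_mulVec_hoverInput, sub_self, Matrix.mulVec_zero]

theorem model_hover (p : V3) (ψ : ℝ) : P.model ((0, 0, p, ![0, 0, ψ]), P.hoverInput) = 0 := by
  simp only [model, accel_hover, Matrix.mulVec_zero]
  rfl

end Params

/-! ### Smoothness of the model -/

section Smoothness

variable {E : Type*} [NormedAddCommGroup E] [NormedSpace ℝ E] {k : WithTop ℕ∞} {x : E}

@[fun_prop]
theorem contDiffAt_rot {η : V3} : ContDiffAt ℝ k rot η := by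
  unfold rot
  fun_prop

@[fun_prop]
theorem contDiffAt_Gam {η : V3} : ContDiffAt ℝ k Gam η := by
  unfold Gam
  fun_prop

theorem rotPartials_apply (η : V3) (i a b : Fin 3) :
    rotPartials η (i, a) b = fderiv ℝ (fun ξ => rot ξ a b) η (Pi.single i 1) := by
  have hrot : DifferentiableAt ℝ (fun ξ => rot ξ a b) η :=
    (contDiffAt_matrix.1 contDiffAt_rot a b).differentiableAt one_ne_zero
  exact (hrot.hasFDerivAt.comp_hasDerivAt_of_eq _ (hasDerivAt_update η i (η i)) (by simp)).deriv

@[fun_prop]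
theorem contDiffAt_rotPartials {η : V3} : ContDiffAt ℝ k rotPartials η := by
  refine contDiffAt_matrix.2 fun ⟨i, a⟩ b => ?_
  simp only [rotPartials_apply]
  exact ((contDiffAt_matrix.1 contDiffAt_rot a b).fderiv_right le_rfl).clm_apply contDiffAt_const

@[fun_prop]
theorem contDiffAt_skew {a : V3} : ContDiffAt ℝ k skew a := by
  unfold skew
  fun_prop

@[fun_prop]
theorem contDiffAt_MF {η : V3} : ContDiffAt ℝ k MF η := by
  unfold MF
  fun_prop

namespace Params

variable (P : Params)

@[fun_prop]
theorem contDiffAt_By {η : V3} : ContDiffAt ℝ k P.By η := by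
  unfold By
  fun_prop

theorem contDiffAt_M3 {v η : E → V3} (hv : ContDiffAt ℝ k v x) (hη : ContDiffAt ℝ k η x)
    (hx : IsUnit (Gam (η x)).det) : ContDiffAt ℝ k (fun y => P.M3 (v y) (η y)) x := by
  have hΓ : ContDiffAt ℝ k (fun y => (Gam (η y))⁻¹) x := contDiffAt_matrix_inv (by fun_prop) hx
  have hkron : ContDiffAt ℝ k (fun y => Matrix.of fun (i : Fin 3) (p : Fin 3 × Fin 3) =>
      ((Gam (η y))⁻¹)ᵀ i p.1 * v y p.2) x :=
    contDiffAt_matrix.2 fun i p =>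
      (contDiffAt_matrix.1 hΓ p.1 i).mul (contDiffAt_pi.1 hv p.2)
  have hR : ContDiffAt ℝ k (fun y => rotPartials (η y)) x := by fun_prop
  exact (contDiffAt_matrix_mul (contDiffAt_matrix_mul hkron hR)
    (contDiffAt_const (c := skew P.rhat))).const_smul P.mtot

theorem contDiffAt_M5 {v ω η : E → V3} (hv : ContDiffAt ℝ k v x) (hω : ContDiffAt ℝ k ω x)
    (hη : ContDiffAt ℝ k η x) (hx : IsUnit (Gam (η x)).det) :
    ContDiffAt ℝ k (fun y => P.M5 (v y) (ω y) (η y)) x := by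
  have hM3 := contDiffAt_M3 P hv hη hx
  unfold M5 Cy Gy M2
  fun_prop

theorem contDiffAt_accel {v ω η : E → V3} {F : E → Input} (hv : ContDiffAt ℝ k v x)
    (hω : ContDiffAt ℝ k ω x) (hη : ContDiffAt ℝ k η x) (hF : ContDiffAt ℝ k F x)
    (hB : IsUnit (P.By (η x)).det) (hx : IsUnit (Gam (η x)).det) :
    ContDiffAt ℝ k (fun y => P.accel (v y) (ω y) (η y) (F y)) x := by
  have hM5 := contDiffAt_M5 P hv hω hη hx
  have hBy : ContDiffAt ℝ k (fun y => (P.By (η y))⁻¹) x := contDiffAt_matrix_inv (by fun_prop) hB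
  unfold accel
  fun_prop

theorem contDiffAt_model {q : State × Input} (hB : IsUnit (P.By q.1.2.2.2).det)
    (hq : IsUnit (Gam q.1.2.2.2).det) : ContDiffAt ℝ k P.model q := by
  have hacc : ContDiffAt ℝ k
      (fun q : State × Input => P.accel q.1.1 q.1.2.1 q.1.2.2.2 q.2) q :=
    contDiffAt_accel P (by fun_prop) (by fun_prop) (by fun_prop) (by fun_prop) hB hq
  have hΓ : ContDiffAt ℝ k (fun q : State × Input => (Gam q.1.2.2.2)⁻¹) q :=
    contDiffAt_matrix_inv (by fun_prop) hq
  rw [contDiffAt_pi] at hacc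
  exact (contDiffAt_pi.2 fun i => hacc (.inl i)).prodMk
    ((contDiffAt_pi.2 fun i => hacc (.inr i)).prodMk (by fun_prop))

end Params

end Smoothness

/-! ### Linearization at hover -/

namespace Params

variable {P : Params}

theorem Nondegenerate.differentiableAt_model_hover (hP : P.Nondegenerate) :
    DifferentiableAt ℝ P.model (0, P.hoverInput) :=
  (contDiffAt_model P (hP.isUnit_det_By _) (by simp [Gam_zero])).differentiableAt one_ne_zero

theorem model_zero_hoverInput (P : Params) : P.model (0, P.hoverInput) = 0 := by
  have h0 : (![0, 0, 0] : V3) = 0 := by simp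
  have h := P.model_hover 0 0
  rwa [h0] at h

theorem Nondegenerate.hasDerivAt_model_hover (hP : P.Nondegenerate) (x : State) (u : Input) :
    HasDerivAt (fun t : ℝ => P.model (t • x, P.hoverInput + t • u))
      (fderiv ℝ P.model (0, P.hoverInput) (x, u)) 0 := by
  have hline : HasDerivAt (fun t : ℝ => (t • x, P.hoverInput + t • u)) (x, u) 0 := by
    simpa using ((hasDerivAt_id (0 : ℝ)).smul_const x).prodMk
      (((hasDerivAt_id (0 : ℝ)).smul_const u).const_add P.hoverInput)
  exact hP.differentiableAt_model_hover.hasFDerivAt.comp_hasDerivAt_of_eq 0 hline (by simp)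

theorem Nondegenerate.fderiv_model_hover_kinematics (hP : P.Nondegenerate) (x : State) (u : Input) :
    (fderiv ℝ P.model (0, P.hoverInput) (x, u)).2.2 = (x.1, x.2.1) := by
  have hmodel : HasDerivAt (fun t : ℝ => (t • x.1, (Gam (t • x.2.2.2))⁻¹ *ᵥ (t • x.2.1)))
      (fderiv ℝ P.model (0, P.hoverInput) (x, u)).2.2 0 :=
    (hP.hasDerivAt_model_hover x u).snd.snd
  have hv (a : V3) : HasDerivAt (fun t : ℝ => t • a) a 0 := by
    simpa using (hasDerivAt_id (0 : ℝ)).smul_const a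
  have hΓ : DifferentiableAt ℝ (fun t : ℝ => (Gam (t • x.2.2.2))⁻¹) 0 :=
    (contDiffAt_matrix_inv (by fun_prop) (by simp [Gam_zero])).differentiableAt one_ne_zero
  have hη := hasDerivAt_matrix_mulVec_of_eq_zero hΓ (hv x.2.1) (zero_smul ℝ _)
  rw [zero_smul, Gam_zero, inv_one, Matrix.one_mulVec] at hη
  exact hmodel.unique ((hv x.1).prodMk hη)

theorem Nondegenerate.horizontal_force_balance (hP : P.Nondegenerate) (v ω η : V3) (F : Input) :
    let f := (rot η)ᵀ *ᵥ (P.accel v ω η F ∘ Sum.inl) + skew P.rhat *ᵥ (P.accel v ω η F ∘ Sum.inr)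
    let c := skew ω *ᵥ (skew P.rhat *ᵥ ω)
    f 0 = P.g * Real.sin (η 1) - c 0 ∧
      f 1 = -(P.g * (Real.sin (η 0) * Real.cos (η 1))) - c 1 := by
  intro f c
  have h : P.mtot • f = F 0 • e3 - P.mtot • (c + P.g • _) := hP.body_force_balance v ω η F
  rw [Gam_mulVec_e3] at h
  constructor <;> refine mul_left_cancel₀ hP.mtot_ne_zero ?_
  · have h0 : P.mtot * f 0 = F 0 * 0 - P.mtot * (c 0 + P.g * -Real.sin (η 1)) := congrFun h 0
    linarith
  · have h1 : P.mtot * f 1 =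
      F 0 * 0 - P.mtot * (c 1 + P.g * (Real.sin (η 0) * Real.cos (η 1))) := congrFun h 1
    linarith

theorem Nondegenerate.hasDerivAt_body_accel (hP : P.Nondegenerate) (x : State) (u : Input) :
    let y (t : ℝ) := P.model (t • x, P.hoverInput + t • u)
    let w := fderiv ℝ P.model (0, P.hoverInput) (x, u)
    HasDerivAt (fun t => (rot (t • x.2.2.2))ᵀ *ᵥ (y t).1 + skew P.rhat *ᵥ (y t).2.1)
      (w.1 + skew P.rhat *ᵥ w.2.1) 0 := by
  intro y w
  have hy : HasDerivAt y w 0 := hP.hasDerivAt_model_hover x u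
  have hy0 : y 0 = 0 := by simpa [y] using P.model_zero_hoverInput
  have hrot : DifferentiableAt ℝ (fun t : ℝ => (rot (t • x.2.2.2))ᵀ) 0 :=
    (show ContDiffAt ℝ 1 _ _ by fun_prop).differentiableAt one_ne_zero
  have hsum := (hasDerivAt_matrix_mulVec_of_eq_zero hrot hy.fst (congrArg Prod.fst hy0)).add
    (hasDerivAt_matrix_mulVec_of_eq_zero (differentiableAt_const (skew P.rhat)) hy.snd.fst
      (congrArg (·.2.1) hy0))
  rwa [zero_smul, rot_zero, Matrix.transpose_one, Matrix.one_mulVec] at hsum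

theorem Nondegenerate.fderiv_model_hover_horizontal (hP : P.Nondegenerate) (x : State) (u : Input) :
    let w := fderiv ℝ P.model (0, P.hoverInput) (x, u)
    (w.1 + skew P.rhat *ᵥ w.2.1) 0 = P.g * x.2.2.2 1 ∧
      (w.1 + skew P.rhat *ᵥ w.2.1) 1 = -(P.g * x.2.2.2 0) := by
  intro w
  have hforce := hasDerivAt_pi.1 (hP.hasDerivAt_body_accel x u)
  set c := skew x.2.1 *ᵥ (skew P.rhat *ᵥ x.2.1) with hc
  have hcor (t : ℝ) : skew (t • x.2.1) *ᵥ (skew P.rhat *ᵥ (t • x.2.1)) = t ^ 2 • c := by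
    ext i
    fin_cases i <;> simp [skew_mulVec, hc] <;> ring
  have hbal (t : ℝ) := hP.horizontal_force_balance (t • x.1) (t • x.2.1) (t • x.2.2.2)
    (P.hoverInput + t • u)
  simp only [hcor, Pi.smul_apply, smul_eq_mul] at hbal
  have hlin (a : ℝ) : HasDerivAt (fun t => t * a) a 0 := by
    simpa using (hasDerivAt_id (0 : ℝ)).mul_const a
  have hsq (a : ℝ) : HasDerivAt (fun t => t ^ 2 * a) 0 0 := by
    simpa using (hasDerivAt_pow 2 (0 : ℝ)).mul_const a
  have hsin (a : ℝ) : HasDerivAt (fun t => Real.sin (t * a)) a 0 := by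
    simpa using (hlin a).sin
  have hcos (a : ℝ) : HasDerivAt (fun t => Real.cos (t * a)) 0 0 := by
    simpa using (hlin a).cos
  constructor
  · have h := ((hsin (x.2.2.2 1)).const_mul P.g).sub (hsq (c 0))
    rw [sub_zero] at h
    exact (hforce 0).unique (h.congr_of_eventuallyEq (.of_forall fun t => (hbal t).1))
  · have h := (((hsin (x.2.2.2 0)).mul (hcos (x.2.2.2 1))).const_mul P.g).neg.sub (hsq (c 1))
    simp only [zero_mul, Real.cos_zero, mul_one, mul_zero, add_zero, sub_zero] at h
    exact (hforce 1).unique (h.congr_of_eventuallyEq (.of_forall fun t => (hbal t).2))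

theorem Nondegenerate.fderiv_model_hover_tilt (hP : P.Nondegenerate) {x : State} {u : Input}
    (hp : (fderiv ℝ P.model (0, P.hoverInput) (x, u)).1 = 0)
    (hω : (fderiv ℝ P.model (0, P.hoverInput) (x, u)).2.1 2 = 0) :
    P.α * (fderiv ℝ P.model (0, P.hoverInput) (x, u)).2.1 0 = -(P.g * x.2.2.2 0) ∧
      P.α * (fderiv ℝ P.model (0, P.hoverInput) (x, u)).2.1 1 = -(P.g * x.2.2.2 1) := by
  have h := hP.fderiv_model_hover_horizontal x u
  simp only [hp, zero_add, skew_mulVec, rhat_two, hω, Matrix.cons_val, mul_zero, zero_sub,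
    sub_zero] at h
  exact ⟨h.2, by rw [← h.1, neg_neg]⟩

end Params

/-! ### The zero dynamics -/

/-- The embedding of the zero dynamics states `(ω_x, ω_y, φ, θ, ψ)` as the states with
`p = p' = 0` and `ω_z = 0`. -/
noncomputable def zeroOutputEmbedding : (Fin 5 → ℝ) →L[ℝ] State :=
  LinearMap.toContinuousLinearMap
    { toFun := fun z => (0, ![z 0, z 1, 0], 0, ![z 2, z 3, z 4])
      map_add' := fun y z => by simp
      map_smul' := fun c z => by simp }

/-- The projection of a state to the zero dynamics coordinates `(ω_x, ω_y, φ, θ, ψ)`. -/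
noncomputable def zeroDynCoord : State →L[ℝ] (Fin 5 → ℝ) :=
  LinearMap.toContinuousLinearMap
    { toFun := fun x => ![x.2.1 0, x.2.1 1, x.2.2.2 0, x.2.2.2 1, x.2.2.2 2]
      map_add' := fun x y => by simp
      map_smul' := fun c x => by simp }

theorem zeroOutputEmbedding_apply (z : Fin 5 → ℝ) :
    zeroOutputEmbedding z = (0, ![z 0, z 1, 0], 0, ![z 2, z 3, z 4]) := rfl

theorem zeroDynCoord_zeroOutputEmbedding (z : Fin 5 → ℝ) :
    zeroDynCoord (zeroOutputEmbedding z) = z := by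
  ext i
  fin_cases i <;> rfl

theorem zeroOutputEmbedding_zeroDynCoord {x : State} (hv : x.1 = 0) (hp : x.2.2.1 = 0)
    (hω : x.2.1 2 = 0) : zeroOutputEmbedding (zeroDynCoord x) = x := by
  refine Prod.ext hv.symm (Prod.ext ?_ (Prod.ext hp.symm ?_)) <;> ext i <;> fin_cases i
  exacts [rfl, rfl, hω.symm, rfl, rfl, rfl]

namespace Params
variable {P : Params}

/-- The closed-loop input of the zero dynamics at the state `z`. -/
noncomputable def zeroDynInput (P : Params) (z : Fin 5 → ℝ) : Input :=
  P.linearizingInput 0 ![z 0, z 1, 0] ![z 2, z 3, z 4] 0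

theorem zeroDyn_eq (P : Params) (z : Fin 5 → ℝ) :
    P.zeroDyn z = zeroDynCoord (P.model (zeroOutputEmbedding z, P.zeroDynInput z)) := rfl

namespace Nondegenerate

theorem model_zeroOutputEmbedding (hP : P.Nondegenerate) (hα : P.α ≠ 0) (z : Fin 5 → ℝ) :
    P.model (zeroOutputEmbedding z, P.zeroDynInput z) = zeroOutputEmbedding (P.zeroDyn z) := by
  have h0 := outSel_mulVec_accel_linearizingInput ![z 2, z 3, z 4]
    (hP.isUnit_det_M4_mul_MF hα _) 0 ![z 0, z 1, 0] 0
  obtain ⟨hacc, hyaw⟩ := outSel_mulVec_eq_zero_iff.1 h0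
  exact (zeroOutputEmbedding_zeroDynCoord hacc rfl hyaw).symm

theorem zeroDynInput_zero (hP : P.Nondegenerate) (hα : P.α ≠ 0) :
    P.zeroDynInput 0 = P.hoverInput := by
  have hM5 : P.M5 0 ![0, 0, 0] ![0, 0, 0] = MF ![0, 0, 0] *ᵥ P.hoverInput := by
    rw [MF_mulVec_hoverInput]
    congr 1
    simp
  change P.linearizingInput 0 ![0, 0, 0] ![0, 0, 0] 0 = P.hoverInput
  rw [linearizingInput, zero_add, hM5, Matrix.mulVec_mulVec P.hoverInput,
    Matrix.mulVec_mulVec, Matrix.nonsing_inv_mul _ (hP.isUnit_det_M4_mul_MF hα _),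
    Matrix.one_mulVec]

theorem zeroDyn_zero (hP : P.Nondegenerate) (hα : P.α ≠ 0) : P.zeroDyn 0 = 0 := by
  rw [zeroDyn_eq, hP.zeroDynInput_zero hα, map_zero, model_zero_hoverInput, map_zero]

theorem contDiffAt_zeroDynInput (hP : P.Nondegenerate) (hα : P.α ≠ 0) {k : WithTop ℕ∞} :
    ContDiffAt ℝ k P.zeroDynInput 0 := by
  have hη : ContDiffAt ℝ k (fun z : Fin 5 → ℝ => (![z 2, z 3, z 4] : V3)) 0 := by fun_prop
  have hM4 : ContDiffAt ℝ k (fun z : Fin 5 → ℝ => P.M4 ![z 2, z 3, z 4]) 0 := by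
    have hBy : ContDiffAt ℝ k (fun z : Fin 5 → ℝ => (P.By ![z 2, z 3, z 4])⁻¹) 0 :=
      contDiffAt_matrix_inv (by fun_prop) (hP.isUnit_det_By _)
    unfold M4
    fun_prop
  have hinv : ContDiffAt ℝ k
      (fun z : Fin 5 → ℝ => (P.M4 ![z 2, z 3, z 4] * MF ![z 2, z 3, z 4])⁻¹) 0 :=
    contDiffAt_matrix_inv (by fun_prop) (hP.isUnit_det_M4_mul_MF hα _)
  have hM5 : ContDiffAt ℝ k
      (fun z : Fin 5 → ℝ => P.M5 0 ![z 0, z 1, 0] ![z 2, z 3, z 4]) 0 :=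
    contDiffAt_M5 P contDiffAt_const (by fun_prop) hη (by simp [det_Gam])
  unfold zeroDynInput linearizingInput
  fun_prop

theorem contDiffAt_zeroDyn (hP : P.Nondegenerate) (hα : P.α ≠ 0) {k : WithTop ℕ∞} :
    ContDiffAt ℝ k P.zeroDyn 0 := by
  have hmodel : ContDiffAt ℝ k P.model (zeroOutputEmbedding 0, P.zeroDynInput 0) :=
    contDiffAt_model P (hP.isUnit_det_By _) (by simp [Gam_zero])
  exact zeroDynCoord.contDiff.contDiffAt.comp 0
    (hmodel.comp 0 (zeroOutputEmbedding.contDiff.contDiffAt.prodMk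
      (hP.contDiffAt_zeroDynInput hα)))

theorem exists_zeroOutputEmbedding_fderiv_zeroDyn (hP : P.Nondegenerate) (hα : P.α ≠ 0)
    (z : Fin 5 → ℝ) : ∃ u, zeroOutputEmbedding (fderiv ℝ P.zeroDyn 0 z) =
      fderiv ℝ P.model (0, P.hoverInput) (zeroOutputEmbedding z, u) := by
  have hzd : HasFDerivAt P.zeroDyn (fderiv ℝ P.zeroDyn 0) 0 :=
    ((hP.contDiffAt_zeroDyn hα).differentiableAt one_ne_zero).hasFDerivAt
  have hu : HasFDerivAt P.zeroDynInput (fderiv ℝ P.zeroDynInput 0) 0 :=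
    ((hP.contDiffAt_zeroDynInput hα).differentiableAt one_ne_zero).hasFDerivAt
  have hpath := (zeroOutputEmbedding.hasFDerivAt (x := 0)).prodMk hu
  have hmodel := hP.differentiableAt_model_hover.hasFDerivAt
  rw [← map_zero zeroOutputEmbedding, ← hP.zeroDynInput_zero hα] at hmodel
  have hcomp := hmodel.comp 0 hpath
  have hemb := (zeroOutputEmbedding.hasFDerivAt (x := P.zeroDyn 0)).comp 0 hzd
  have heq := hcomp.unique (hemb.congr_of_eventuallyEq
    (.of_forall fun y => hP.model_zeroOutputEmbedding hα y))
  refine ⟨fderiv ℝ P.zeroDynInput 0 z, ?_⟩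
  rw [map_zero, hP.zeroDynInput_zero hα] at heq
  exact (DFunLike.congr_fun heq z).symm

theorem fderiv_zeroDyn_zero (hP : P.Nondegenerate) (hα : P.α ≠ 0) :
    fderiv ℝ P.zeroDyn 0 =
      LinearMap.toContinuousLinearMap (Matrix.mulVecLin P.zeroDynJacobian) := by
  ext1 z
  obtain ⟨u, hu⟩ := hP.exists_zeroOutputEmbedding_fderiv_zeroDyn hα z
  have hkin := hP.fderiv_model_hover_kinematics (zeroOutputEmbedding z) u
  have htilt := hP.fderiv_model_hover_tilt (x := zeroOutputEmbedding z) (u := u)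
    (by rw [← hu]; rfl) (by rw [← hu]; rfl)
  rw [← hu] at hkin htilt
  set w := fderiv ℝ P.zeroDyn 0 z
  obtain ⟨hx, hy⟩ : P.α * w 0 = -(P.g * z 2) ∧ P.α * w 1 = -(P.g * z 3) := htilt
  have hη : (![w 2, w 3, w 4] : V3) = ![z 0, z 1, 0] := (Prod.ext_iff.1 hkin).2
  simp only [Matrix.vecCons_inj] at hη
  have hdiv {a b : ℝ} (h : P.α * a = -(P.g * b)) : a = -P.g / P.α * b := by
    field_simp
    linarith
  ext i
  fin_cases i <;>
    simp [zeroDynJacobian, Matrix.mulVec, dotProduct, Fin.sum_univ_five, hη, hdiv hx, hdiv hy]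

theorem hasFDerivAt_zeroDyn_zero (hP : P.Nondegenerate) (hα : P.α ≠ 0) :
    HasFDerivAt P.zeroDyn
      (LinearMap.toContinuousLinearMap (Matrix.mulVecLin P.zeroDynJacobian)) 0 := by
  rw [← hP.fderiv_zeroDyn_zero hα]
  exact ((hP.contDiffAt_zeroDyn hα).differentiableAt one_ne_zero).hasFDerivAt

end Nondegenerate

open Polynomial in
theorem charpoly_zeroDynJacobian (P : Params) :
    P.zeroDynJacobian.charpoly = X * (X ^ 2 - C (-P.g / P.α)) ^ 2 := by
  have hchar : P.zeroDynJacobian.charmatrix =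
      !![X, 0, -C (-P.g / P.α), 0, 0; 0, X, 0, -C (-P.g / P.α), 0; -1, 0, X, 0, 0;
        0, -1, 0, X, 0; 0, 0, 0, 0, X] := by
    ext i j : 2
    fin_cases i <;> fin_cases j <;> simp [zeroDynJacobian]
  rw [Matrix.charpoly, hchar]
  simp only [Matrix.det_succ_row_zero, Matrix.det_unique, Matrix.of_apply, Matrix.submatrix_apply,
    Matrix.cons_val, Fin.sum_univ_succ, Fin.succAbove, Fin.default_eq_zero,
    Fin.coe_ofNat_eq_mod, Fin.reduceSucc, Fin.reduceCastSucc, Fin.reduceLT, ↓reduceIte]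
  ring

theorem roots_charpoly_zeroDynJacobian (P : Params) {s : ℂ}
    (hs : s ^ 2 = ((-P.g / P.α : ℝ) : ℂ)) :
    (P.zeroDynJacobian.map (fun r : ℝ => (r : ℂ))).charpoly.roots = {0, s, s, -s, -s} := by
  have h : (P.zeroDynJacobian.map (fun r : ℝ => (r : ℂ))).charpoly =
      (({0, s, s, -s, -s} : Multiset ℂ).map fun a => Polynomial.X - Polynomial.C a).prod := by
    rw [show (P.zeroDynJacobian.map (fun r : ℝ => (r : ℂ))) =
      P.zeroDynJacobian.map Complex.ofRealHom from rfl, Matrix.charpoly_map,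
      charpoly_zeroDynJacobian]
    simp only [Polynomial.map_mul, Polynomial.map_pow, Polynomial.map_sub, Polynomial.map_X,
      Polynomial.map_C, Complex.ofRealHom_eq_coe, ← hs, Multiset.insert_eq_cons,
      Multiset.map_cons, Multiset.prod_cons, Multiset.map_singleton, Multiset.prod_singleton,
      map_pow, map_neg, map_zero]
    ring
  rw [h, Polynomial.roots_multiset_prod_X_sub_C]

namespace Nondegenerate

theorem zero_mem_constrainedLinearization (hP : P.Nondegenerate) (s : ℝ) :
    (0 : State) ∈ P.constrainedLinearization (s • zeroOutputEmbedding ![0, 0, 0, 0, 1]) := by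
  set e := zeroOutputEmbedding ![0, 0, 0, 0, 1] with he
  have heq (t : ℝ) : t • e = (0, 0, 0, ![0, 0, t]) := by
    rw [he, zeroOutputEmbedding_apply]
    simp
  have hout : OutputZero (s • e) := by
    rw [heq]
    exact ⟨rfl, rfl⟩
  have hconst : HasDerivAt (fun t : ℝ => P.model (t • e, P.hoverInput + t • 0)) 0 0 := by
    simpa only [heq, smul_zero, add_zero, model_hover] using hasDerivAt_const (0 : ℝ) (0 : State)
  have hderiv := (hP.hasDerivAt_model_hover e 0).unique hconst
  refine ⟨hout, 0, ?_⟩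
  have hsmul : (s • e, (0 : Input)) = s • (e, 0) := Prod.ext rfl (smul_zero s).symm
  rw [hsmul, map_smul, hderiv, smul_zero]

theorem exists_oscillator_equations (hP : P.Nondegenerate) (hg : P.g ≠ 0) {T : ℝ} (hT : 0 < T)
    {x : ℝ → State} (hx : IsSolution P.constrainedLinearization T x) :
    ∃ ω' : ℝ → V3, ∀ t ∈ Icc 0 T, (x t).1 = 0 ∧
      HasDerivWithinAt (fun s => (x s).2.1) (ω' t) (Icc 0 T) t ∧
      HasDerivWithinAt (fun s => (x s).2.2.2) (x t).2.1 (Icc 0 T) t ∧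
      P.α / P.g * ω' t 0 = -(x t).2.2.2 0 ∧ P.α / P.g * ω' t 1 = -(x t).2.2.2 1 := by
  choose! w hw hder using hx
  choose hout u hu using hw
  have hkin (t) (ht : t ∈ Icc 0 T) : (w t).2.2 = ((x t).1, (x t).2.1) := by
    rw [hu t ht, hP.fderiv_model_hover_kinematics]
  have hvel (t) (ht : t ∈ Icc 0 T) : (x t).1 = 0 := by
    have h := eq_zero_of_hasDerivWithinAt_of_eqOn_zero hT ht (hder t ht).snd.snd.fst
      fun s hs => (hout s hs).1
    rwa [hkin t ht] at h
  refine ⟨fun t => (w t).2.1, fun t ht => ⟨hvel t ht, (hder t ht).snd.fst, ?_, ?_⟩⟩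
  · have hη : HasDerivWithinAt (fun s => (x s).2.2.2) (w t).2.2.2 (Icc 0 T) t :=
      (hder t ht).snd.snd.snd
    rwa [hkin t ht] at hη
  have hacc : (w t).1 = 0 :=
    eq_zero_of_hasDerivWithinAt_of_eqOn_zero hT ht (hder t ht).fst hvel
  have hyaw : (w t).2.1 2 = 0 := eq_zero_of_hasDerivWithinAt_of_eqOn_zero hT ht
    (hasDerivWithinAt_pi.1 (hder t ht).snd.fst 2) fun s hs => (hout s hs).2
  rw [hu t ht] at hacc hyaw
  obtain ⟨hroll, hpitch⟩ := hP.fderiv_model_hover_tilt hacc hyaw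
  rw [← hu t ht] at hroll hpitch
  constructor
  · rw [div_mul_eq_mul_div, hroll, ← mul_neg, mul_div_cancel_left₀ _ hg]
  · rw [div_mul_eq_mul_div, hpitch, ← mul_neg, mul_div_cancel_left₀ _ hg]

theorem norm_le_of_isSolution (hP : P.Nondegenerate) (hg : 0 < P.g) (hα : 0 ≤ P.α) {T : ℝ}
    (hT : 0 < T) {x : ℝ → State} (hx : IsSolution P.constrainedLinearization T x) {t : ℝ}
    (ht : t ∈ Icc 0 T) : ‖x t‖ ≤ (1 + P.α / P.g + (P.α / P.g)⁻¹) * ‖x 0‖ := by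
  obtain ⟨ω', h⟩ := hP.exists_oscillator_equations hg.ne' hT hx
  choose hv hω hη hroll hpitch using h
  have hout (s) (hs : s ∈ Icc 0 T) : OutputZero (x s) := (hx s hs).choose_spec.1.1
  have hκ : 0 ≤ P.α / P.g := div_nonneg hα hg.le
  have hω0 (i : Fin 3) : |(x 0).2.1 i| ≤ ‖x 0‖ :=
    (norm_le_pi_norm (x 0).2.1 i).trans ((norm_fst_le _).trans (norm_snd_le _))
  have hη0 (i : Fin 3) : |(x 0).2.2.2 i| ≤ ‖x 0‖ := (norm_le_pi_norm (x 0).2.2.2 i).trans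
    ((norm_snd_le _).trans ((norm_snd_le _).trans (norm_snd_le _)))
  have hωi (i : Fin 3) (s) (hs : s ∈ Icc 0 T) := hasDerivWithinAt_pi.1 (hω s hs) i
  have hηi (i : Fin 3) (s) (hs : s ∈ Icc 0 T) := hasDerivWithinAt_pi.1 (hη s hs) i
  obtain ⟨hωx, hφ⟩ := abs_le_of_oscillator hT hκ (hωi 0) (hηi 0) hroll (hω0 0) (hη0 0) t ht
  obtain ⟨hωy, hθ⟩ := abs_le_of_oscillator hT hκ (hωi 1) (hηi 1) hpitch (hω0 1) (hη0 1) t ht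
  have hψ : (x t).2.2.2 2 = (x 0).2.2.2 2 :=
    eq_of_hasDerivWithinAt_zero (fun s hs => (hout s hs).2 ▸ hηi 2 s hs) t ht
  have hC : ‖x 0‖ ≤ (1 + P.α / P.g + (P.α / P.g)⁻¹) * ‖x 0‖ := by
    have := inv_nonneg.2 hκ
    exact le_mul_of_one_le_left (norm_nonneg _) (by linarith)
  have hC0 := (norm_nonneg (x 0)).trans hC
  have hωt : ‖(x t).2.1‖ ≤ (1 + P.α / P.g + (P.α / P.g)⁻¹) * ‖x 0‖ := by
    refine (pi_norm_le_iff_of_nonneg hC0).2 fun i => ?_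
    fin_cases i
    exacts [hωx, hωy, by simpa [(hout t ht).2] using hC0]
  have hηt : ‖(x t).2.2.2‖ ≤ (1 + P.α / P.g + (P.α / P.g)⁻¹) * ‖x 0‖ := by
    refine (pi_norm_le_iff_of_nonneg hC0).2 fun i => ?_
    fin_cases i
    exacts [hφ, hθ, by simpa [hψ] using (hη0 2).trans hC]
  simp only [norm_prod_le_iff, hv t ht, (hout t ht).1, norm_zero]
  exact ⟨hC0, hωt, hC0, hηt⟩

theorem marginallyStable_constrainedLinearization (hP : P.Nondegenerate) (hg : 0 < P.g)
    (hα : 0 ≤ P.α) : MarginallyStable P.constrainedLinearization :=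
  ⟨lyapunovStable_of_norm_le fun _ hT _ hx _ ht => hP.norm_le_of_isSolution hg hα hT hx ht,
    not_attractive_of_zero_mem
      (fun h => one_ne_zero (congrFun (congrArg (·.2.2.2) h) 2 : (1 : ℝ) = 0))
      hP.zero_mem_constrainedLinearization⟩

theorem marginallyStable_ode_fderiv_zeroDyn (hP : P.Nondegenerate) (hg : 0 < P.g)
    (hα : 0 < P.α) : MarginallyStable (ode (fun z => fderiv ℝ P.zeroDyn 0 z)) := by
  constructor
  · refine (hP.marginallyStable_constrainedLinearization hg hα.le).1.of_map
      (L := zeroOutputEmbedding) zeroDynCoord_zeroOutputEmbedding ?_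
    rintro z _ rfl
    obtain ⟨u, hu⟩ := hP.exists_zeroOutputEmbedding_fderiv_zeroDyn hα.ne' z
    exact ⟨⟨rfl, rfl⟩, u, hu⟩
  · refine not_attractive_of_zero_mem (e := Pi.single 4 1) (by simp) fun s => ?_
    have hker : P.zeroDynJacobian *ᵥ Pi.single 4 1 = 0 := by
      ext i
      fin_cases i <;> simp [zeroDynJacobian]
    simp only [ode, mem_singleton_iff, map_smul, hP.fderiv_zeroDyn_zero hα.ne',
      LinearMap.coe_toContinuousLinearMap', Matrix.mulVecLin_apply, hker, smul_zero]

theorem unstable_ode_zeroDyn (hP : P.Nondegenerate) (hg : 0 < P.g) (hα : P.α < 0) :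
    Unstable (ode P.zeroDyn) := by
  set k := -P.g / P.α with hk_def
  have hk : 0 < k := div_pos_of_neg_of_neg (neg_neg_of_pos hg) hα
  let pr (i : Fin 5) : (Fin 5 → ℝ) →L[ℝ] ℝ := ContinuousLinearMap.proj i
  -- The term `-ψ²` leaves room for `c V` on the yaw axis, where the linear field vanishes.
  let B : (Fin 5 → ℝ) →L[ℝ] (Fin 5 → ℝ) →L[ℝ] ℝ :=
    (pr 0).smulRight (pr 2) + (pr 1).smulRight (pr 3) - (pr 4).smulRight (pr 4)
  have hB (x y : Fin 5 → ℝ) : B x y = x 0 * y 2 + x 1 * y 3 - x 4 * y 4 := rfl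
  set c := min 1 k
  have hc : 0 < c := lt_min one_pos hk
  have hc1 : c ≤ 1 := min_le_left 1 k
  have hck : c ≤ k := min_le_right 1 k
  refine unstable_ode_of_bilinear (hP.contDiffAt_zeroDyn hα.ne) (hP.hasFDerivAt_zeroDyn_zero hα.ne)
    (hP.zeroDyn_zero hα.ne) (B := B) hc (half_pos hc) (fun x => ?_) (x₀ := ![1, 0, 1, 0, 0])
    (by simp [hB])
  have hAx : P.zeroDynJacobian *ᵥ x = ![k * x 2, k * x 3, x 0, x 1, 0] := by
    ext i
    fin_cases i <;> simp [zeroDynJacobian, Matrix.mulVec, dotProduct, Fin.sum_univ_five, hk_def]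
  have hnorm : ‖x‖ ^ 2 ≤ x 0 ^ 2 + x 1 ^ 2 + x 2 ^ 2 + x 3 ^ 2 + x 4 ^ 2 := by
    rw [← Fin.sum_univ_five fun i => x i ^ 2]
    exact sq_norm_le_sum_sq x
  have hplane (a b : ℝ) : c * (a * b) + c / 2 * (a ^ 2 + b ^ 2) ≤ a ^ 2 + k * b ^ 2 := by
    nlinarith [mul_nonneg hc.le (sq_nonneg (a - b)), mul_le_mul_of_nonneg_right hc1 (sq_nonneg a),
      mul_le_mul_of_nonneg_right hck (sq_nonneg b)]
  rw [LinearMap.coe_toContinuousLinearMap', Matrix.mulVecLin_apply, hAx, hB, hB, hB]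
  simp only [Matrix.cons_val]
  nlinarith [hplane (x 0) (x 2), hplane (x 1) (x 3), mul_nonneg hc.le (sq_nonneg (x 4)),
    mul_le_mul_of_nonneg_left hnorm hc.le]

end Nondegenerate

end Params

end UAVPayload

theorem theorem1_general (P : UAVPayload.Params) (hg : 0 < P.g) (hP : P.Nondegenerate) :
    (P.α ≠ 0 →
      (∀ η : UAVPayload.V3, IsUnit (P.M4 η * UAVPayload.MF η).det) ∧
      P.zeroDyn 0 = 0 ∧
      HasFDerivAt P.zeroDyn
        (LinearMap.toContinuousLinearMap (Matrix.mulVecLin P.zeroDynJacobian)) 0 ∧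
      ∀ s : ℂ, s ^ 2 = ((-P.g / P.α : ℝ) : ℂ) →
        (P.zeroDynJacobian.map (fun r : ℝ => (r : ℂ))).charpoly.roots = {0, s, s, -s, -s}) ∧
    (P.α < 0 → UAVPayload.Unstable (UAVPayload.ode P.zeroDyn)) ∧
    (0 < P.α →
      UAVPayload.MarginallyStable
        (UAVPayload.ode (fun z : Fin 5 → ℝ => fderiv ℝ P.zeroDyn 0 z))) ∧
    P.model (0, P.hoverInput) = 0 ∧
    DifferentiableAt ℝ P.model (0, P.hoverInput) ∧
    (0 ≤ P.α → UAVPayload.MarginallyStable P.constrainedLinearization) :=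
  ⟨fun hα => ⟨hP.isUnit_det_M4_mul_MF hα, hP.zeroDyn_zero hα, hP.hasFDerivAt_zeroDyn_zero hα,
      fun _ => P.roots_charpoly_zeroDynJacobian⟩,
    hP.unstable_ode_zeroDyn hg, hP.marginallyStable_ode_fderiv_zeroDyn hg,
    P.model_zero_hoverInput, hP.differentiableAt_model_hover,
    hP.marginallyStable_constrainedLinearization hg⟩

theorem theorem1 (P : UAVPayload.Params) (hg : 0 < P.g) (hmU : 0 < P.mUAV) (hmP : 0 ≤ P.mPL)
    (hHU : P.HUAV.PosDef) (hHP : P.HPL.PosSemidef) :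
    -- the zero dynamics are well defined for `α ≠ 0`; equilibrium, Jacobian and eigenvalues
    (P.α ≠ 0 →
      (∀ η : UAVPayload.V3, IsUnit (P.M4 η * UAVPayload.MF η).det) ∧
      P.zeroDyn 0 = 0 ∧
      HasFDerivAt P.zeroDyn
        (LinearMap.toContinuousLinearMap (Matrix.mulVecLin P.zeroDynJacobian)) 0 ∧
      ∀ s : ℂ, s ^ 2 = ((-P.g / P.α : ℝ) : ℂ) →
        (P.zeroDynJacobian.map (fun r : ℝ => (r : ℂ))).charpoly.roots = {0, s, s, -s, -s}) ∧
    -- instability of the nonlinear zero dynamics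
    (P.α < 0 → UAVPayload.Unstable (UAVPayload.ode P.zeroDyn)) ∧
    -- marginal stability of the linearized zero dynamics
    (0 < P.α →
      UAVPayload.MarginallyStable
        (UAVPayload.ode (fun z : Fin 5 → ℝ => fderiv ℝ P.zeroDyn 0 z))) ∧
    -- the same, as zero-output dynamics of the linearized model, with `α = 0` included
    P.model (0, P.hoverInput) = 0 ∧
    DifferentiableAt ℝ P.model (0, P.hoverInput) ∧
    (0 ≤ P.α → UAVPayload.MarginallyStable P.constrainedLinearization) :=
  theorem1_general P hg (UAVPayload.Params.nondegenerate_of_posDef hmU hmP hHU hHP)
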